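/- Fix $T\ge 0$ and let $\Omega=D^+[0,T]$ be the set of all càdlàg functions $\omega:[0,T]\to[0,\infty)$. For $t\in[0,T]$ let $\mathcal F^\circ_t$ be the smallest $\sigma$-algebra on $\Omega$ making all $\omega\mapsto\omega(s)$, $s\in[0,t]$, measurable, and let $\mathcal F_t$ be its universal completion; stopping times $\tau:\Omega\to[0,T]\cup\{\infty\}$ and the $\sigma$-algebras $\mathcal F_\tau$ are taken with respect to $(\mathcal F_t)$. A simple trading strategy $G$ consists of an initial capital $c\in\mathbb R$, stopping times $\tau_1\le\tau_2\le\cdots$ such that for each $\omega$ only finitely many $\tau_n(\omega)$ are finite, and bounded $\mathcal F_{\tau_n}$-measurable functions $h_n:\Omega\to\mathbb R$. Its capital process is $$\mathcal K^G_t(\omega)=c+\sum_{n=1}^\infty h_n(\omega)\bigl(\omega(\tau_{n+1}\wedge t)-\omega(\tau_n\wedge t)\bigr),\qquad t\in[0,T].$$ A positive capital process is a process $S$, i.e. a family of functions $S_t:\Omega\to[0,\infty]$ with each $S_t$ being $\mathcal F_t$-measurable, of the form $S_t(\omega)=\sum_{m=1}^\infty\mathcal K^{G_m}_t(\omega)$,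 where $\mathcal K^{G_m}_t(\omega)\ge0$ for all $m$, $t$, $\omega$, and the initial capitals $c_m$ of $G_m$ satisfy $\sum_m c_m<\infty$. A set $E\subseteq\Omega$ is null if there is a positive capital process $S$ with $S_0=1$ and $S_T(\omega)=\infty$ for all $\omega\in E$. A property holds for typical $\omega\in D^+[0,T]$ if the set of $\omega\in\Omega$ where it fails is null. Proposition. Suppose $\phi:(0,\infty)\to(0,\infty)$ satisfies $$\sup_{0<t\le s\le 2t}\frac{\phi(s)}{\phi(t)}<\infty\qquad\text{and}\qquad\sum_{j=0}^\infty 2^{2j}\phi(2^{-j})<\infty,$$ and set $\phi(0):=0$. Then, for typical $\omega\in D^+[0,T]$, $$\mathrm{var}_\phi(\omega):=\sup\sum_{i=1}^n\phi\bigl(|\omega(t_i)-\omega(t_{i-1})|\bigr)<\infty,$$ where the supremum is over all $n\ge1$ and all partitions $0=t_0\le t_1\le\cdots\le t_n=T$. -/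

import Mathlib

open MeasureTheory Filter Topology
open scoped ENNReal NNReal

namespace CadlagPrice

/-- The time interval `[0, T]`. -/
abbrev Time (T : ℝ≥0) : Type := Set.Icc (0 : ℝ) (T : ℝ)

/-- Time `0`. -/
def startTime (T : ℝ≥0) : Time T := ⟨0, le_refl 0, T.2⟩

/-- The horizon `T`. -/
def endTime (T : ℝ≥0) : Time T := ⟨T, T.2, le_refl _⟩

instance (T : ℝ≥0) : Nonempty (Time T) := ⟨startTime T⟩

/-- The sample space `D⁺[0,T]` of càdlàg functions `[0,T] → [0,∞)`. -/
structure Path (T : ℝ≥0) where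
  /-- The underlying function. -/
  toFun : Time T → ℝ
  nonneg : ∀ t, 0 ≤ toFun t
  rightCont : ∀ t, ContinuousWithinAt toFun (Set.Ioi t) t
  leftLim : ∀ t, ∃ l : ℝ, Tendsto toFun (𝓝[<] t) (𝓝 l)

instance (T : ℝ≥0) : CoeFun (Path T) (fun _ => Time T → ℝ) := ⟨Path.toFun⟩

/-- The universal completion of a σ-algebra `m`: the intersection over all probability measures
`μ` on `m` of the `μ`-completions of `m`. -/
@[reducible] def universalCompletion {Ω : Type*} (m : MeasurableSpace Ω) : MeasurableSpace Ω where
  MeasurableSet' s :=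
    ∀ μ : @Measure Ω m, @IsProbabilityMeasure Ω m μ → @NullMeasurableSet Ω m s μ
  measurableSet_empty := fun _ _ => nullMeasurableSet_empty
  measurableSet_compl := fun _ hs μ hμ => (hs μ hμ).compl
  measurableSet_iUnion := fun _ hs μ hμ => NullMeasurableSet.iUnion fun i => hs i μ hμ

theorem universalCompletion_mono {Ω : Type*} {m₁ m₂ : MeasurableSpace Ω} (h : m₁ ≤ m₂) :
    universalCompletion m₁ ≤ universalCompletion m₂ := by
  intro s hs μ hμ
  have hp : @IsProbabilityMeasure Ω m₁ (μ.trim h) :=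
    @IsProbabilityMeasure.mk Ω m₁ (μ.trim h) (by
      rw [trim_measurableSet_eq h MeasurableSet.univ]; exact hμ.measure_univ)
  obtain ⟨t, ht, hst⟩ := hs (μ.trim h) hp
  exact ⟨t, h t ht, ae_eq_of_ae_eq_trim hst⟩

/-- `𝓕°_t`: the smallest σ-algebra making all `ω ↦ ω(s)`, `s ∈ [0,t]`, measurable. -/
@[reducible] def rawSigma (T : ℝ≥0) (t : Time T) : MeasurableSpace (Path T) :=
  ⨆ (s : Time T) (_ : s ≤ t), MeasurableSpace.comap (fun ω : Path T => ω s) (borel ℝ)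

theorem rawSigma_mono (T : ℝ≥0) : Monotone (rawSigma T) := fun _ _ hst =>
  iSup_mono fun _ => iSup_mono' fun hr => ⟨hr.trans hst, le_refl _⟩

/-- The filtration `(𝓕_t)`, where `𝓕_t` is the universal completion of `𝓕°_t`. -/
def pathFiltration (T : ℝ≥0) :
    @Filtration (Path T) (Time T) _ (universalCompletion (rawSigma T (endTime T))) :=
  @Filtration.mk (Path T) (Time T) _ (universalCompletion (rawSigma T (endTime T)))
    (fun t => universalCompletion (rawSigma T t))
    (fun _ _ hst => universalCompletion_mono (rawSigma_mono T hst))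
    (fun t => universalCompletion_mono (rawSigma_mono T t.2.2))

/-- A simple trading strategy. Its stopping times `τ 0 ≤ τ 1 ≤ ⋯` take values in
`[0,T] ∪ {∞} = WithTop (Time T)`, and `h n` is the position taken at time `τ n`. -/
structure SimpleStrategy (T : ℝ≥0) where
  /-- The initial capital. -/
  c : ℝ
  /-- The stopping times. -/
  τ : ℕ → Path T → WithTop (Time T)
  /-- The positions. -/
  h : ℕ → Path T → ℝ
  isStoppingTime : ∀ n, IsStoppingTime (pathFiltration T) (τ n)
  mono : ∀ n ω, τ n ω ≤ τ (n + 1) ω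
  finite : ∀ ω, {n : ℕ | τ n ω ≠ ⊤}.Finite
  bounded : ∀ n, ∃ C : ℝ, ∀ ω, |h n ω| ≤ C
  measurable : ∀ n, Measurable[(isStoppingTime n).measurableSpace] (h n)

/-- The simple capital process of `G`:
`c + ∑ n, h n ω * (ω (τ (n + 1) ∧ t) - ω (τ n ∧ t))`; only finitely many terms are nonzero. -/
noncomputable def SimpleStrategy.capital {T : ℝ≥0} (G : SimpleStrategy T) (t : Time T)
    (ω : Path T) : ℝ :=
  G.c + ∑ᶠ n : ℕ, G.h n ω *
    (stoppedProcess (fun s (ω' : Path T) => ω' s) (G.τ (n + 1)) t ω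
      - stoppedProcess (fun s (ω' : Path T) => ω' s) (G.τ n) t ω)

/-- A positive capital process: an adapted `[0,∞]`-valued process that is the sum of a sequence of
everywhere nonnegative simple capital processes with summable initial capitals. -/
def IsPositiveCapitalProcess {T : ℝ≥0} (S : Time T → Path T → ℝ≥0∞) : Prop :=
  Adapted (pathFiltration T) S ∧
    ∃ G : ℕ → SimpleStrategy T,
      (∀ m t ω, 0 ≤ (G m).capital t ω) ∧
      Summable (fun m => (G m).c) ∧
      ∀ t ω, S t ω = ∑' m, ENNReal.ofReal ((G m).capital t ω)

/-- A set of paths is null if some positive capital process starting from `1` is infinite at time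
`T` on all of it. -/
def IsNull {T : ℝ≥0} (E : Set (Path T)) : Prop :=
  ∃ S : Time T → Path T → ℝ≥0∞, IsPositiveCapitalProcess S ∧
    (∀ ω, S (startTime T) ω = 1) ∧ ∀ ω ∈ E, S (endTime T) ω = ∞

/-- A property holds for typical `ω ∈ D⁺[0,T]` if the set where it fails is null. -/
def ForTypical {T : ℝ≥0} (P : Path T → Prop) : Prop := IsNull {ω : Path T | ¬ P ω}

/-- The `φ`-variation of `f : [0,T] → ℝ`, the supremum over all partitions
`0 = t₀ ≤ t₁ ≤ ⋯ ≤ tₙ = T`, `n ≥ 1`, of `∑ i, φ(|f(tᵢ) - f(tᵢ₋₁)|)`. -/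
noncomputable def phiVariation {T : ℝ≥0} (φ : ℝ≥0 → ℝ≥0) (f : Time T → ℝ) : ℝ≥0∞ :=
  ⨆ (n : ℕ) (_ : 1 ≤ n) (t : Fin (n + 1) → Time T) (_ : Monotone t)
    (_ : t 0 = startTime T) (_ : t (Fin.last n) = endTime T),
    ∑ i : Fin n, (φ ‖f (t i.succ) - f (t i.castSucc)‖₊ : ℝ≥0∞)

end CadlagPrice

namespace CadlagPrice

variable {T : ℝ≥0}

/-! For `K ≥ 0` let `g(x) = K² - ((K - x)⁺)²`, a concave function with `0 ≤ g ≤ K²` on `[0,∞)`. At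
scale `ε`, follow the path by a centre that is reconsidered each time the path gets `ε` away from it
and that moves only by distances of at least `ε/2`. Holding `g'(centre)` from capital `K²` keeps the
capital nonnegative on every path, since `g` lies below its tangents. On paths bounded by `K` the
gap between tangent and `g` is exactly the squared move, so the final capital is at least `(ε/2)²`
times the number of moves (`le_capital_walkStrategy`). That number bounds, for any partition, the
number of increments of size at least `2ε` (`card_le_walkMoves`).

Take `2ε = 2⁻ʲ`, with final capital `Uⱼ`. Doubling bounds `φ(d)` by a constant times the sum of
`φ(2⁻ʲ)` over `2⁻ʲ ≤ d`, so the variation is at most a constant times `∑ⱼ 4ʲ φ(2⁻ʲ) Uⱼ`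
(`phiVariation_le_of_doubling`). The series hypothesis makes these weights summable. Mixing over
`j`, and over `K = 2ᴸ` to reach every path, gives one positive capital process that is infinite
wherever the variation is. -/

theorem le_endTime (t : Time T) : t ≤ endTime T := t.2.2

theorem startTime_le (t : Time T) : startTime T ≤ t := t.2.1

theorem le_universalCompletion {Ω : Type*} (m : MeasurableSpace Ω) :
    m ≤ universalCompletion m :=
  fun _ hs _ _ => MeasurableSet.nullMeasurableSet hs

/-! ### Stopped values and measurability of capital processes. -/

theorem measurable_eval {s t : Time T} (h : s ≤ t) :
    Measurable[pathFiltration T t] (fun ω : Path T => ω s) := by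
  have h1 : MeasurableSpace.comap (fun ω : Path T => ω s) (borel ℝ) ≤ pathFiltration T t :=
    (le_iSup₂_of_le (f := fun (s : Time T) (_ : s ≤ t) =>
      MeasurableSpace.comap (fun ω : Path T => ω s) (borel ℝ)) s h le_rfl).trans
      (le_universalCompletion _)
  intro B hB
  refine h1 _ ⟨B, ?_, rfl⟩
  rwa [← BorelSpace.measurable_eq (α := ℝ)]

/-- The value of a path at the time `s ∧ t`. -/
noncomputable def valueAt (ω : Path T) (s : WithTop (Time T)) (t : Time T) : ℝ :=
  ω (min (t : WithTop (Time T)) s).untopA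

theorem valueAt_of_ge (ω : Path T) {s : WithTop (Time T)} {t : Time T} (h : (t : WithTop _) ≤ s) :
    valueAt ω s t = ω t := by
  simp [valueAt, min_eq_left h]

theorem valueAt_coe (ω : Path T) {s t : Time T} (h : s ≤ t) :
    valueAt ω (s : WithTop _) t = ω s := by
  have : (s : WithTop (Time T)) ≤ t := by exact_mod_cast h
  simp [valueAt, min_eq_right this]

theorem SimpleStrategy.capital_eq (G : SimpleStrategy T) (t : Time T) (ω : Path T) :
    G.capital t ω = G.c + ∑ᶠ n : ℕ, G.h n ω *
      (valueAt ω (G.τ (n + 1) ω) t - valueAt ω (G.τ n ω) t) := rfl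

theorem measurable_stoppedTime {ρ : Path T → WithTop (Time T)}
    (hρ : IsStoppingTime (pathFiltration T) ρ) (t : Time T) :
    Measurable[pathFiltration T t]
      (fun ω => (((min (t : WithTop (Time T)) (ρ ω)).untopA : Time T) : ℝ)) := by
  let _ : MeasurableSpace (Path T) := pathFiltration T t
  refine measurable_of_Iic fun x => ?_
  by_cases hx : (t : ℝ) ≤ x
  · convert MeasurableSet.univ using 1
    refine Set.eq_univ_of_forall fun ω => ?_
    have : (min (t : WithTop (Time T)) (ρ ω)).untopA ≤ t := by
      rw [WithTop.untopA_eq_untop (by simp), WithTop.untop_le_iff]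
      exact min_le_left _ _
    exact le_trans (by exact_mod_cast this) hx
  · push Not at hx
    by_cases hx0 : 0 ≤ x
    · let s : Time T := ⟨x, hx0, hx.le.trans t.2.2⟩
      have hs : s ≤ t := hx.le
      have key : MeasurableSet {ω | ρ ω ≤ s} := (pathFiltration T).mono hs _ (hρ s)
      convert key using 1
      ext ω
      have hst : ¬ (t : WithTop (Time T)) ≤ s := by
        rw [WithTop.coe_le_coe]; exact not_le.2 hx
      have : (min (t : WithTop (Time T)) (ρ ω)).untopA ≤ s ↔ ρ ω ≤ s := by
        rw [WithTop.untopA_eq_untop (by simp), WithTop.untop_le_iff, min_le_iff]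
        simp [hst]
      exact this
    · convert MeasurableSet.empty using 1
      refine Set.eq_empty_of_forall_notMem fun ω h => hx0 ?_
      exact le_trans (min (t : WithTop (Time T)) (ρ ω)).untopA.2.1 h

/-- The time `k / (n + 1)`, cut off at `t`. -/
noncomputable def gridTime (t : Time T) (n k : ℕ) : Time T :=
  ⟨min (t : ℝ) (k / (n + 1)), le_min t.2.1 (by positivity), (min_le_left _ _).trans t.2.2⟩

/-- Rounding up approaches `s` from the right, where the path is continuous; the cut-off at `t`
keeps the approximation adapted. -/
theorem tendsto_eval_gridTime (ω : Path T) {s t : Time T} (hst : s ≤ t) :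
    Tendsto (fun n : ℕ => ω (gridTime t n ⌈((n : ℝ) + 1) * s⌉₊)) atTop (𝓝 (ω s)) := by
  have hge : ∀ n : ℕ, s ≤ gridTime t n ⌈((n : ℝ) + 1) * s⌉₊ := by
    intro n
    rw [← Subtype.coe_le_coe]
    refine le_min hst ?_
    rw [le_div_iff₀ (by positivity), mul_comm]
    exact Nat.le_ceil _
  have hle : ∀ n : ℕ, (gridTime t n ⌈((n : ℝ) + 1) * s⌉₊ : ℝ) ≤ s + 1 / ((n : ℝ) + 1) := by
    intro n
    refine (min_le_right _ _).trans ?_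
    have h0 : 0 ≤ ((n : ℝ) + 1) * s := mul_nonneg (by positivity) s.2.1
    have hn : (n : ℝ) + 1 ≠ 0 := by positivity
    rw [div_le_iff₀ (by positivity)]
    refine (Nat.ceil_lt_add_one h0).le.trans_eq ?_
    field_simp
  have hlim : Tendsto (fun n : ℕ => gridTime t n ⌈((n : ℝ) + 1) * s⌉₊) atTop (𝓝 s) := by
    rw [tendsto_subtype_rng]
    refine tendsto_of_tendsto_of_tendsto_of_le_of_le tendsto_const_nhds ?_ hge hle
    simpa using (tendsto_const_nhds (x := (s : ℝ))).add tendsto_one_div_add_atTop_nhds_zero_nat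
  have hcont : ContinuousWithinAt ω.toFun (Set.Ici s) s :=
    continuousWithinAt_Ioi_iff_Ici.1 (ω.rightCont s)
  exact hcont.tendsto.comp
    (tendsto_nhdsWithin_iff.2 ⟨hlim, Eventually.of_forall hge⟩)

theorem measurable_valueAt {ρ : Path T → WithTop (Time T)}
    (hρ : IsStoppingTime (pathFiltration T) ρ) (t : Time T) :
    Measurable[pathFiltration T t] (fun ω => valueAt ω (ρ ω) t) := by
  let _ : MeasurableSpace (Path T) := pathFiltration T t
  have hr := measurable_stoppedTime hρ t
  refine measurable_of_tendsto_metrizable (f := fun (n : ℕ) (ω : Path T) =>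
    ω (gridTime t n ⌈((n : ℝ) + 1) * ((min (t : WithTop (Time T)) (ρ ω)).untopA : Time T)⌉₊))
    (fun n => ?_) (tendsto_pi_nhds.2 fun ω => tendsto_eval_gridTime ω ?_)
  · have h1 : Measurable (fun p : ℕ × Path T => p.2 (gridTime t n p.1)) :=
      measurable_from_prod_countable_right fun k =>
        have h : gridTime t n k ≤ t := Subtype.coe_le_coe.1 (min_le_left _ _)
        measurable_eval h
    exact h1.comp ((Nat.measurable_ceil.comp (hr.const_mul _)).prodMk measurable_id)
  · rw [WithTop.untopA_eq_untop (by simp), WithTop.untop_le_iff]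
    exact min_le_left _ _

theorem le_iSup_pathFiltration (t : Time T) : pathFiltration T t ≤ ⨆ s, pathFiltration T s :=
  le_iSup (fun s => (pathFiltration T s : MeasurableSpace (Path T))) t

theorem measurable_valueAt_stopping {ρ : Path T → WithTop (Time T)}
    (hρ : IsStoppingTime (pathFiltration T) ρ) :
    Measurable[hρ.measurableSpace] (fun ω => valueAt ω (ρ ω) (endTime T)) := by
  intro B hB
  refine ⟨le_iSup_pathFiltration _ _ (measurable_valueAt hρ (endTime T) hB), fun t => ?_⟩
  convert (measurable_valueAt hρ t hB).inter (hρ t) using 1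
  ext ω
  simp only [Set.mem_inter_iff, Set.mem_preimage]
  refine and_congr_left fun h => ?_
  obtain ⟨s, hs, -⟩ := WithTop.le_coe_iff.1 (show ρ ω ≤ t from h)
  have hst : s ≤ t := by rw [Set.mem_ofPred_eq, hs] at h; exact_mod_cast h
  rw [hs, valueAt_coe ω hst, valueAt_coe ω (le_endTime s)]

/-- An `𝓕_ρ`-measurable function is known at time `t` only on `{ρ ≤ t}`. The capital process needs
no more: a position not yet taken has gained nothing. -/
theorem measurable_indicator_stopping {ρ : Path T → WithTop (Time T)}
    (hρ : IsStoppingTime (pathFiltration T) ρ) {f : Path T → ℝ}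
    (hf : Measurable[hρ.measurableSpace] f) (t : Time T) :
    Measurable[pathFiltration T t] ({ω | ρ ω ≤ t}.indicator f) := by
  let _ : MeasurableSpace (Path T) := pathFiltration T t
  intro B hB
  have h1 : MeasurableSet (f ⁻¹' B ∩ {ω | ρ ω ≤ t}) := (hf hB).2 t
  have h2 : MeasurableSet {ω | ρ ω ≤ t} := hρ t
  classical
  rw [Set.indicator_preimage, Set.ite]
  exact h1.union (((measurable_const : Measurable fun _ : Path T => (0 : ℝ)) hB).diff h2)

theorem SimpleStrategy.finite_support_gains (G : SimpleStrategy T) (t : Time T) (ω : Path T) :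
    (Function.support fun n : ℕ => G.h n ω *
      (valueAt ω (G.τ (n + 1) ω) t - valueAt ω (G.τ n ω) t)).Finite := by
  refine (G.finite ω).subset fun n hn htop => hn ?_
  have htop' : G.τ (n + 1) ω = ⊤ := top_le_iff.1 (htop ▸ G.mono n ω)
  simp [htop, htop']

theorem SimpleStrategy.measurable_capital (G : SimpleStrategy T) (t : Time T) :
    Measurable[pathFiltration T t] (G.capital t) := by
  let _ : MeasurableSpace (Path T) := pathFiltration T t
  have hterm : ∀ n, Measurable (fun ω => G.h n ω *
      (valueAt ω (G.τ (n + 1) ω) t - valueAt ω (G.τ n ω) t)) := by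
    intro n
    have h1 := measurable_indicator_stopping (G.isStoppingTime n) (G.measurable n) t
    have h2 := (measurable_valueAt (G.isStoppingTime (n + 1)) t).sub
      (measurable_valueAt (G.isStoppingTime n) t)
    convert h1.mul h2 using 1
    ext ω
    by_cases h : G.τ n ω ≤ t
    · simp [h]
    · have h' : (t : WithTop (Time T)) ≤ G.τ n ω := (not_le.1 h).le
      simp [valueAt_of_ge ω h', valueAt_of_ge ω (h'.trans (G.mono n ω))]
  have hfun : G.capital t = fun ω => G.c + ∑ᶠ n : ℕ, G.h n ω *
      (valueAt ω (G.τ (n + 1) ω) t - valueAt ω (G.τ n ω) t) := rfl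
  rw [hfun]
  refine measurable_const.add ?_
  refine measurable_of_tendsto_metrizable (f := fun (N : ℕ) (ω : Path T) =>
    ∑ n ∈ Finset.range N, G.h n ω *
      (valueAt ω (G.τ (n + 1) ω) t - valueAt ω (G.τ n ω) t))
    (fun N => Finset.measurable_sum _ fun n _ => hterm n) (tendsto_pi_nhds.2 fun ω => ?_)
  have hfin := G.finite_support_gains t ω
  rw [← tsum_eq_finsum (L := .unconditional ℕ) hfin]
  have hsum := hasSum_sum_of_ne_finset_zero (L := .unconditional ℕ) (s := hfin.toFinset)
    fun n hn => by
      simpa only [Set.Finite.mem_toFinset, Function.mem_support, not_not] using hn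
  exact hsum.summable.hasSum.tendsto_sum_nat

theorem SimpleStrategy.capital_startTime (G : SimpleStrategy T) (ω : Path T) :
    G.capital (startTime T) ω = G.c := by
  have h0 : ∀ s : WithTop (Time T), (startTime T : WithTop (Time T)) ≤ s := by
    intro s
    cases s with
    | top => exact le_top
    | coe s => exact_mod_cast startTime_le s
  simp [SimpleStrategy.capital_eq, valueAt_of_ge ω (h0 _)]

theorem isNull_of_strategies {E : Set (Path T)} (G : ℕ → SimpleStrategy T)
    (hc0 : ∀ m, 0 ≤ (G m).c)
    (hG : ∀ m t ω, 0 ≤ (G m).capital t ω) (hc : ∑' m, ENNReal.ofReal (G m).c = 1)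
    (hE : ∀ ω ∈ E, ∑' m, ENNReal.ofReal ((G m).capital (endTime T) ω) = ∞) : IsNull E := by
  refine ⟨fun t ω => ∑' m, ENNReal.ofReal ((G m).capital t ω),
    ⟨fun t => ?_, G, hG, ?_, fun _ _ => rfl⟩, fun ω => ?_, hE⟩
  · let _ : MeasurableSpace (Path T) := pathFiltration T t
    exact Measurable.tsum fun m => ((G m).measurable_capital t).ennreal_ofReal
  · have := ENNReal.summable_toReal (hc.trans_ne ENNReal.one_ne_top)
    simpa [ENNReal.toReal_ofReal, hc0] using this
  · simpa [SimpleStrategy.capital_startTime] using hc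

/-! ### Exit times from a neighbourhood. -/

/-- Times `t ≥ s` such that `|ω - x|` has reached or approached the level `ε` on `[s, t]`. -/
def exceedTimes (ε : ℝ) (ω : Path T) (s : WithTop (Time T)) (x : ℝ) : Set (Time T) :=
  {t | s ≤ t ∧ ∀ c < ε, ∃ r : Time T, s ≤ r ∧ r ≤ t ∧ c < |ω r - x|}

theorem Path.exists_gt_forall_Ioo (ω : Path T) {s : Time T} {U : Set ℝ} (hU : U ∈ 𝓝 (ω s))
    {t : Time T} (hst : s < t) : ∃ u, s < u ∧ u ≤ t ∧ ∀ r, s < r → r < u → ω r ∈ U := by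
  obtain ⟨u, hu, h⟩ := (mem_nhdsGT_iff_exists_mem_Ioc_Ioo_subset hst).1 ((ω.rightCont s) hU)
  exact ⟨u, hu.1, hu.2, fun r h1 h2 => h ⟨h1, h2⟩⟩

/-- Right continuity makes the infimum attained: a deviation bounded by some `c < ε` up to the
infimum stays below a larger `c' < ε` slightly beyond it. -/
theorem exists_isLeast_exceedTimes (ε : ℝ) (ω : Path T) (s : WithTop (Time T)) (x : ℝ)
    (h : (exceedTimes ε ω s x).Nonempty) : ∃ t, IsLeast (exceedTimes ε ω s x) t := by
  have hcpt : ∃ u, IsGLB (exceedTimes ε ω s x) u := by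
    have : Fact ((0 : ℝ) ≤ T) := ⟨T.2⟩
    let _ : CompleteLattice (Time T) := inferInstance
    exact ⟨sInf (exceedTimes ε ω s x), isGLB_sInf _⟩
  obtain ⟨u, hu⟩ := hcpt
  by_cases hmem : u ∈ exceedTimes ε ω s x
  · exact ⟨u, hmem, hu.1⟩
  exfalso
  have hsu : s ≤ u := by
    obtain ⟨t, ht⟩ := h
    obtain ⟨s', rfl, -⟩ := WithTop.le_coe_iff.1 ht.1
    exact_mod_cast hu.2 fun t ht => by exact_mod_cast ht.1
  have hlt : ∀ t ∈ exceedTimes ε ω s x, u < t := fun t ht =>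
    lt_of_le_of_ne (hu.1 ht) fun h => hmem (h ▸ ht)
  have : ∃ c < ε, ∀ r : Time T, s ≤ r → r ≤ u → |ω r - x| ≤ c := by
    simpa [exceedTimes, hsu] using hmem
  obtain ⟨c, hc, hbd⟩ := this
  obtain ⟨t, ht⟩ := h
  obtain ⟨c', hcc', hc'⟩ := exists_between hc
  have hU : {y : ℝ | |y - x| < c'} ∈ 𝓝 (ω u) :=
    (isOpen_lt (by fun_prop) continuous_const).mem_nhds ((hbd u hsu le_rfl).trans_lt hcc')
  obtain ⟨v, huv, -, hv⟩ := ω.exists_gt_forall_Ioo hU (hlt t ht)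
  obtain ⟨t', ht', -, htv⟩ := hu.exists_between huv
  obtain ⟨r, hsr, hrt, hr⟩ := ht'.2 c' hc'
  rcases le_or_gt r u with h | h
  · exact absurd (hr.trans_le (hbd r hsr h)) (not_lt.2 hcc'.le)
  · exact lt_asymm hr (hv r h (hrt.trans_lt htv))

open Classical in
/-- The first time after `s` at which `|ω - x|` reaches or approaches the level `ε`. -/
noncomputable def nextTime (ε : ℝ) (ω : Path T) (s : WithTop (Time T)) (x : ℝ) :
    WithTop (Time T) :=
  if h : (exceedTimes ε ω s x).Nonempty then
    ((exists_isLeast_exceedTimes ε ω s x h).choose : WithTop (Time T)) else ⊤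

theorem nextTime_le_iff {ε : ℝ} {ω : Path T} {s : WithTop (Time T)} {x : ℝ} {t : Time T} :
    nextTime ε ω s x ≤ t ↔ t ∈ exceedTimes ε ω s x := by
  unfold nextTime
  split_ifs with h
  · have hl := (exists_isLeast_exceedTimes ε ω s x h).choose_spec
    rw [WithTop.coe_le_coe]
    refine ⟨fun hle => ?_, fun ht => hl.2 ht⟩
    have hle' : (((exists_isLeast_exceedTimes ε ω s x h).choose : Time T) : WithTop (Time T))
      ≤ t := by exact_mod_cast hle
    refine ⟨hl.1.1.trans hle', fun c hc => ?_⟩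
    obtain ⟨r, h1, h2, h3⟩ := hl.1.2 c hc
    exact ⟨r, h1, h2.trans hle, h3⟩
  · simpa using fun ht => h ⟨t, ht⟩

theorem le_nextTime (ε : ℝ) (ω : Path T) (s : WithTop (Time T)) (x : ℝ) :
    s ≤ nextTime ε ω s x := by
  cases h : nextTime ε ω s x with
  | top => exact le_top
  | coe t => exact (nextTime_le_iff.1 h.le).1

theorem abs_sub_lt_of_lt_nextTime {ε : ℝ} {ω : Path T} {s : WithTop (Time T)} {x : ℝ}
    {t : Time T} (h1 : s ≤ t) (h2 : t < nextTime ε ω s x) : |ω t - x| < ε := by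
  have : t ∉ exceedTimes ε ω s x := fun h => (nextTime_le_iff.2 h).not_gt h2
  have : ∃ c < ε, ∀ r : Time T, s ≤ r → r ≤ t → |ω r - x| ≤ c := by
    simpa [exceedTimes, h1] using this
  obtain ⟨c, hc, hbd⟩ := this
  exact (hbd t h1 le_rfl).trans_lt hc

/-- The event depends only on the supremum of `|ω - x|` over the elapsed interval, because levels
need only be approached. By right continuity countably many times determine this supremum, provided
`t` itself is among them: it cannot be approximated from the right within the interval. -/
theorem isStoppingTime_nextTime (ε : ℝ) {ρ : Path T → WithTop (Time T)} {x : Path T → ℝ}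
    (hρ : IsStoppingTime (pathFiltration T) ρ) (hx : Measurable[hρ.measurableSpace] x) :
    IsStoppingTime (pathFiltration T) (fun ω => nextTime ε ω (ρ ω) (x ω)) := by
  intro t
  have hD : ∃ D : Set (Time T), D.Countable ∧ Dense D := TopologicalSpace.exists_countable_dense _
  obtain ⟨D, hDc, hDd⟩ := hD
  have hset : ∀ q ≤ t, ∀ c : ℝ, MeasurableSet[pathFiltration T t]
      {ω | ρ ω ≤ q ∧ c < |ω q - x ω|} := by
    intro q hq c
    refine (pathFiltration T).mono hq _ ?_
    let _ : MeasurableSpace (Path T) := pathFiltration T q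
    have h1 : Measurable (fun ω : Path T => |ω q - {ω | ρ ω ≤ q}.indicator x ω|) :=
      (continuous_abs.measurable).comp
        ((measurable_eval le_rfl).sub (measurable_indicator_stopping hρ hx q))
    have h2 : MeasurableSet {ω : Path T | c < |ω q - {ω | ρ ω ≤ q}.indicator x ω|} :=
      h1 measurableSet_Ioi
    have h3 : MeasurableSet {ω | ρ ω ≤ q} := hρ q
    convert h3.inter h2 using 1
    ext ω
    simp only [Set.mem_ofPred_eq, Set.mem_inter_iff]
    refine and_congr_right fun h => ?_
    rw [Set.indicator_of_mem (by exact h)]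
  have key : {ω | nextTime ε ω (ρ ω) (x ω) ≤ t} = {ω | ρ ω ≤ t} ∩
      ⋂ k : ℕ, ⋃ q ∈ insert t (D ∩ Set.Iic t),
        {ω | ρ ω ≤ q ∧ ε - 1 / ((k : ℝ) + 1) < |ω q - x ω|} := by
    ext ω
    simp only [Set.mem_ofPred_eq, nextTime_le_iff, Set.mem_inter_iff, Set.mem_iInter,
      Set.mem_iUnion, exists_prop]
    refine and_congr_right fun hρt => ⟨fun h k => ?_, fun h c hc => ?_⟩
    · obtain ⟨r, hsr, hrt, hr⟩ := h (ε - 1 / ((k : ℝ) + 1)) (sub_lt_self _ (by positivity))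
      rcases hrt.eq_or_lt with rfl | hlt
      · exact ⟨r, Set.mem_insert _ _, hsr, hr⟩
      have hU : {y : ℝ | ε - 1 / ((k : ℝ) + 1) < |y - x ω|} ∈ 𝓝 (ω r) :=
        (isOpen_lt continuous_const (by fun_prop)).mem_nhds hr
      obtain ⟨v, hrv, hvt, hv⟩ := ω.exists_gt_forall_Ioo hU hlt
      obtain ⟨q, hq, hrq, hqv⟩ := hDd.exists_between hrv
      refine ⟨q, Set.mem_insert_of_mem _ ⟨hq, hqv.le.trans hvt⟩, hsr.trans ?_, hv q hrq hqv⟩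
      exact_mod_cast hrq.le
    · obtain ⟨k, hk⟩ := exists_nat_one_div_lt (sub_pos.2 hc)
      obtain ⟨q, hq, hρq, hq'⟩ := h k
      refine ⟨q, hρq, ?_, lt_trans (by linarith) hq'⟩
      rcases hq with rfl | hq
      · exact le_rfl
      · exact hq.2
  have hm : MeasurableSet[pathFiltration T t] ({ω | ρ ω ≤ t} ∩
      ⋂ k : ℕ, ⋃ q ∈ insert t (D ∩ Set.Iic t),
        {ω | ρ ω ≤ q ∧ ε - 1 / ((k : ℝ) + 1) < |ω q - x ω|}) := by
    let _ : MeasurableSpace (Path T) := pathFiltration T t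
    refine MeasurableSet.inter (hρ t) (MeasurableSet.iInter fun k => ?_)
    refine MeasurableSet.biUnion ((hDc.mono Set.inter_subset_left).insert _) fun q hq => ?_
    refine hset q ?_ _
    rcases hq with rfl | hq
    · exact le_rfl
    · exact hq.2
  rw [key]
  exact hm

/-! ### The walk of centres. -/

/-- The successive times at which the path leaves the `ε`-neighbourhood of the current centre,
with the current centre; the centre moves to the new value of the path if that is at a distance
of at least `ε / 2`. -/
noncomputable def walk (ε : ℝ) (ω : Path T) : ℕ → WithTop (Time T) × ℝ
  | 0 => (startTime T, ω (startTime T))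
  | n + 1 =>
    let s := nextTime ε ω (walk ε ω n).1 (walk ε ω n).2
    (s, if ε / 2 ≤ |valueAt ω s (endTime T) - (walk ε ω n).2| then valueAt ω s (endTime T)
      else (walk ε ω n).2)

/-- The times of `walk`. -/
noncomputable def walkTime (ε : ℝ) (n : ℕ) (ω : Path T) : WithTop (Time T) := (walk ε ω n).1

/-- The centres of `walk`. -/
noncomputable def walkCentre (ε : ℝ) (n : ℕ) (ω : Path T) : ℝ := (walk ε ω n).2

theorem walkTime_zero (ε : ℝ) (ω : Path T) : walkTime ε 0 ω = startTime T := rfl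

theorem walkCentre_zero (ε : ℝ) (ω : Path T) : walkCentre ε 0 ω = ω (startTime T) := rfl

theorem walkTime_succ (ε : ℝ) (n : ℕ) (ω : Path T) :
    walkTime ε (n + 1) ω = nextTime ε ω (walkTime ε n ω) (walkCentre ε n ω) := rfl

theorem walkCentre_succ (ε : ℝ) (n : ℕ) (ω : Path T) :
    walkCentre ε (n + 1) ω =
      if ε / 2 ≤ |valueAt ω (walkTime ε (n + 1) ω) (endTime T) - walkCentre ε n ω| then
        valueAt ω (walkTime ε (n + 1) ω) (endTime T) else walkCentre ε n ω := rfl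

theorem walkTime_le_succ (ε : ℝ) (n : ℕ) (ω : Path T) :
    walkTime ε n ω ≤ walkTime ε (n + 1) ω := le_nextTime _ _ _ _

theorem walkTime_mono (ε : ℝ) (ω : Path T) : Monotone fun n => walkTime ε n ω :=
  monotone_nat_of_le_succ fun n => walkTime_le_succ ε n ω

theorem walkCentre_nonneg (ε : ℝ) (n : ℕ) (ω : Path T) : 0 ≤ walkCentre ε n ω := by
  induction n with
  | zero => exact ω.nonneg _
  | succ n ih =>
    rw [walkCentre_succ]
    split_ifs
    · exact ω.nonneg _
    · exact ih

theorem walkCentre_le (ε : ℝ) (n : ℕ) (ω : Path T) {K : ℝ} (hK : ∀ t, ω t ≤ K) :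
    walkCentre ε n ω ≤ K := by
  induction n with
  | zero => exact hK _
  | succ n ih =>
    rw [walkCentre_succ]
    split_ifs
    · exact hK _
    · exact ih

theorem isStoppingTime_and_measurable_walk (ε : ℝ) (n : ℕ) :
    ∃ h : IsStoppingTime (pathFiltration T) (walkTime ε n),
      Measurable[h.measurableSpace] (walkCentre (T := T) ε n) := by
  induction n with
  | zero =>
    have h : IsStoppingTime (pathFiltration T) (walkTime (T := T) ε 0) :=
      isStoppingTime_const _ _
    refine ⟨h, ?_⟩
    convert! measurable_valueAt_stopping h using 2 with ω
    rw [walkTime_zero, valueAt_coe _ (le_endTime _), walkCentre_zero]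
  | succ n ih =>
    obtain ⟨h, hx⟩ := ih
    have h' : IsStoppingTime (pathFiltration T) (walkTime (T := T) ε (n + 1)) :=
      isStoppingTime_nextTime ε h hx
    refine ⟨h', ?_⟩
    have hx' : Measurable[h'.measurableSpace] (walkCentre (T := T) ε n) :=
      hx.mono (h.measurableSpace_mono h' (walkTime_le_succ ε n)) le_rfl
    have hv := measurable_valueAt_stopping h'
    let _ : MeasurableSpace (Path T) := h'.measurableSpace
    have hset : MeasurableSet {ω : Path T | ε / 2 ≤
        |valueAt ω (walkTime ε (n + 1) ω) (endTime T) - walkCentre ε n ω|} :=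
      (continuous_abs.measurable.comp (hv.sub hx')) measurableSet_Ici
    exact Measurable.ite hset hv hx'

/-- This is the point of the rule for moving the centre: even if the path jumps back at the exit
time, it must travel more than `ε / 2` further before the next exit level. -/
theorem abs_eval_sub_walkCentre_lt {ε : ℝ} (hε : 0 < ε) {n : ℕ} {ω : Path T} {s : Time T}
    (hs : walkTime ε n ω = s) : |ω s - walkCentre ε n ω| < ε / 2 := by
  cases n with
  | zero =>
    rw [walkTime_zero, WithTop.coe_inj] at hs
    simpa [← hs, walkCentre_zero] using hε
  | succ n =>
    rw [walkCentre_succ, hs, valueAt_coe ω (le_endTime s)]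
    split_ifs with h
    · simpa using hε
    · exact not_le.1 h

theorem walkTime_lt_succ {ε : ℝ} (hε : 0 < ε) {n : ℕ} {ω : Path T} {s t : Time T}
    (hs : walkTime ε n ω = s) (ht : walkTime ε (n + 1) ω = t) : s < t := by
  have hmem := nextTime_le_iff.1 ((walkTime_succ ε n ω).symm.trans ht).le
  rw [hs] at hmem
  have hle : s ≤ t := by exact_mod_cast hmem.1
  refine lt_of_le_of_ne hle ?_
  rintro rfl
  obtain ⟨r, h1, h2, h3⟩ := hmem.2 (ε / 2) (by linarith)
  obtain rfl : r = s := le_antisymm h2 (by exact_mod_cast h1)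
  exact lt_asymm h3 (abs_eval_sub_walkCentre_lt hε hs)

theorem finite_walkTime_ne_top {ε : ℝ} (hε : 0 < ε) (ω : Path T) :
    {n : ℕ | walkTime ε n ω ≠ ⊤}.Finite := by
  by_contra hinf
  have hne : ∀ n, walkTime ε n ω ≠ ⊤ := by
    intro n
    obtain ⟨m, hm, hnm⟩ := Set.Infinite.exists_gt hinf n
    exact ne_top_of_le_ne_top hm (walkTime_mono ε ω hnm.le)
  choose ρ hρ using fun n => WithTop.ne_top_iff_exists.1 (hne n)
  have hlt : StrictMono ρ := strictMono_nat_of_lt_succ fun n =>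
    walkTime_lt_succ hε (hρ n).symm (hρ (n + 1)).symm
  obtain ⟨u, hu⟩ : ∃ u, IsLUB (Set.range ρ) u := by
    have : Fact ((0 : ℝ) ≤ T) := ⟨T.2⟩
    let _ : CompleteLattice (Time T) := inferInstance
    exact ⟨sSup (Set.range ρ), isLUB_sSup _⟩
  have hρu : ∀ n, ρ n < u := fun n => (hlt n.lt_succ_self).trans_le (hu.1 ⟨n + 1, rfl⟩)
  obtain ⟨l, hl⟩ := ω.leftLim u
  have hU : {y : ℝ | |y - l| < ε / 8} ∈ 𝓝 l :=
    (isOpen_lt (by fun_prop) continuous_const).mem_nhds (by simpa using by positivity)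
  obtain ⟨v, hv, hvu⟩ := (mem_nhdsLT_iff_exists_mem_Ico_Ioo_subset (hρu 0)).1 (hl hU)
  obtain ⟨_, ⟨n, rfl⟩, hn, -⟩ := hu.exists_between hv.2
  have hmem := nextTime_le_iff.1 ((walkTime_succ ε n ω).symm.trans (hρ (n + 1)).symm).le
  -- An oscillation above `3ε/4 - ε/2 = ε/4` contradicts the tolerance `ε/8` around the left limit.
  obtain ⟨r, h1, h2, h3⟩ := hmem.2 (3 * ε / 4) (by linarith)
  rw [← hρ n, WithTop.coe_le_coe] at h1
  have hr : |ω r - l| < ε / 8 := hvu ⟨hn.trans_le h1, h2.trans_lt (hρu _)⟩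
  have hn' : |ω (ρ n) - l| < ε / 8 := hvu ⟨hn, hρu _⟩
  have hc := abs_eval_sub_walkCentre_lt hε (hρ n).symm
  rw [abs_lt] at hr hn' hc
  rw [lt_abs] at h3
  rcases h3 with h3 | h3 <;> linarith

theorem exists_walkTime_le_lt {ε : ℝ} (hε : 0 < ε) (ω : Path T) (t : Time T) :
    ∃ n, walkTime ε n ω ≤ t ∧ t < walkTime ε (n + 1) ω := by
  classical
  have hex : ∃ n, ¬ walkTime ε n ω ≤ t := by
    obtain ⟨n, hn⟩ := (finite_walkTime_ne_top hε ω).infinite_compl.nonempty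
    refine ⟨n, ?_⟩
    have : walkTime ε n ω = ⊤ := by simpa using hn
    simp [this]
  obtain ⟨n, hn⟩ : ∃ n, Nat.find hex = n + 1 := by
    refine Nat.exists_eq_succ_of_ne_zero fun h0 => ?_
    have := Nat.find_spec hex
    rw [h0, walkTime_zero, WithTop.coe_le_coe] at this
    exact this (startTime_le t)
  refine ⟨n, ?_, ?_⟩
  · by_contra h
    have := Nat.find_min' hex h
    omega
  · have := Nat.find_spec hex
    rw [hn] at this
    exact not_le.1 this

/-- One-sided limits give local bounds; compactness makes them global. -/
theorem Path.exists_forall_le (ω : Path T) : ∃ C : ℝ, ∀ t, ω t ≤ C := by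
  have h : BddAbove (ω.toFun '' Set.univ) := by
    refine isCompact_univ.induction_on (p := fun s => BddAbove (ω.toFun '' s)) (by simp)
      (fun s t hst ht => ht.mono (Set.image_mono hst))
      (fun s t hs ht => by rw [Set.image_union]; exact hs.union ht) fun t _ => ?_
    obtain ⟨l, hl⟩ := ω.leftLim t
    have h1 : ∀ᶠ s in 𝓝[<] t, ω s ≤ max (max (l + 1) (ω t + 1)) (ω t) :=
      (hl.eventually_lt_const (lt_add_one l)).mono fun s hs => by
        simp only [le_max_iff]; exact Or.inl (Or.inl hs.le)
    have h2 : ∀ᶠ s in 𝓝[>] t, ω s ≤ max (max (l + 1) (ω t + 1)) (ω t) :=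
      ((ω.rightCont t).tendsto.eventually_lt_const (lt_add_one (ω t))).mono fun s hs => by
        simp only [le_max_iff]; exact Or.inl (Or.inr hs.le)
    have h3 : ∀ᶠ s in 𝓝 t, ω s ≤ max (max (l + 1) (ω t + 1)) (ω t) := by
      rw [← nhdsNE_sup_pure, ← nhdsLT_sup_nhdsGT, eventually_sup, eventually_sup]
      exact ⟨⟨h1, h2⟩, by simp⟩
    refine ⟨_, mem_nhdsWithin_of_mem_nhds h3, max (max (l + 1) (ω t + 1)) (ω t), ?_⟩
    rintro _ ⟨s, hs, rfl⟩
    exact hs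
  obtain ⟨C, hC⟩ := h
  exact ⟨C, fun t => hC ⟨t, Set.mem_univ t, rfl⟩⟩

/-! ### Counting large increments by moves. -/

/-- The number of moves of the centre of `walk` in the first `n` steps. -/
noncomputable def walkMoves (ε : ℝ) (ω : Path T) : ℕ → ℕ
  | 0 => 0
  | n + 1 => walkMoves ε ω n +
      if ε / 2 ≤ |valueAt ω (walkTime ε (n + 1) ω) (endTime T) - walkCentre ε n ω| then 1 else 0

theorem walkMoves_mono (ε : ℝ) (ω : Path T) : Monotone (walkMoves ε ω) :=
  monotone_nat_of_le_succ fun _ => Nat.le_add_right _ _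

theorem walkCentre_eq_of_walkMoves_eq {ε : ℝ} {ω : Path T} {m n : ℕ} (hmn : m ≤ n)
    (h : walkMoves ε ω n = walkMoves ε ω m) : walkCentre ε n ω = walkCentre ε m ω := by
  induction n, hmn using Nat.le_induction with
  | base => rfl
  | succ n hmn ih =>
    have h1 := walkMoves_mono ε ω hmn
    have h2 := walkMoves_mono ε ω (Nat.le_add_right n 1)
    rw [← ih (by omega), walkCentre_succ, if_neg]
    intro hc
    have : walkMoves ε ω (n + 1) = walkMoves ε ω n + 1 := by rw [walkMoves, if_pos hc]
    omega

theorem add_sum_le_last {n : ℕ} (f : Fin (n + 1) → ℕ) (b : Fin n → ℕ)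
    (h : ∀ i, f i.castSucc + b i ≤ f i.succ) : f 0 + ∑ i, b i ≤ f (Fin.last n) := by
  induction n with
  | zero => simp
  | succ n ih =>
    rw [Fin.sum_univ_castSucc]
    have h1 := ih (fun i => f i.castSucc) (fun i => b i.castSucc) fun i => h i.castSucc
    have h2 := h (Fin.last n)
    simp only [Fin.castSucc_zero, Fin.succ_last, Nat.succ_eq_add_one] at h1 h2
    omega

/-- If no move separates two partition points, both lie within `ε` of the same centre; so each
increment of at least `2ε` is charged to a move of its own. -/
theorem card_le_walkMoves {ε : ℝ} (hε : 0 < ε) (ω : Path T) {N : ℕ}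
    (hN : (endTime T : WithTop (Time T)) < walkTime ε (N + 1) ω) {n : ℕ}
    {t : Fin (n + 1) → Time T} (ht : Monotone t) :
    (Finset.univ.filter fun i : Fin n => 2 * ε ≤ |ω (t i.succ) - ω (t i.castSucc)|).card
      ≤ walkMoves ε ω N := by
  choose k hk1 hk2 using fun i => exists_walkTime_le_lt hε ω (t i)
  have hk : ∀ {i j m}, t i ≤ j → (j : WithTop (Time T)) < walkTime ε (m + 1) ω → k i ≤ m := by
    intro i j m hij hjm
    by_contra! h
    have h1 : walkTime ε (m + 1) ω ≤ walkTime ε (k i) ω := walkTime_mono ε ω h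
    have h2 : (t i : WithTop (Time T)) ≤ j := by exact_mod_cast hij
    exact absurd (h1.trans ((hk1 i).trans h2)) (not_le.2 hjm)
  rw [Finset.card_filter]
  refine le_trans ?_ (walkMoves_mono ε ω (hk (le_endTime (t (Fin.last n))) hN))
  refine le_trans (Nat.le_add_left _ _)
    (add_sum_le_last (fun i => walkMoves ε ω (k i)) _ fun i => ?_)
  have hle : k i.castSucc ≤ k i.succ := hk (ht i.castSucc_lt_succ.le) (hk2 _)
  have hm := walkMoves_mono ε ω hle
  split_ifs with h
  · refine lt_of_le_of_ne hm fun heq => ?_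
    have h1 : |ω (t i.succ) - walkCentre ε (k i.succ) ω| < ε :=
      abs_sub_lt_of_lt_nextTime (hk1 _) (hk2 _)
    have h2 : |ω (t i.castSucc) - walkCentre ε (k i.castSucc) ω| < ε :=
      abs_sub_lt_of_lt_nextTime (hk1 _) (hk2 _)
    rw [walkCentre_eq_of_walkMoves_eq hle heq.symm] at h1
    have h3 := abs_sub_le (ω (t i.succ)) (walkCentre ε (k i.castSucc) ω) (ω (t i.castSucc))
    rw [abs_sub_comm (walkCentre ε (k i.castSucc) ω)] at h3
    linarith
  · simpa using hm

/-! ### The strategy and its capital. -/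

/-- The strategy that holds `a g'(x)` at the centre `x` of `walk`, where
`g(x) = K² - ((K - x)⁺)²`, and starts with the capital `a K²`. -/
noncomputable def walkStrategy {ε : ℝ} (hε : 0 < ε) (a K : ℝ) : SimpleStrategy T where
  c := a * K ^ 2
  τ := walkTime ε
  h n ω := a * (2 * max (K - walkCentre ε n ω) 0)
  isStoppingTime n := (isStoppingTime_and_measurable_walk ε n).1
  mono n ω := walkTime_le_succ ε n ω
  finite ω := finite_walkTime_ne_top hε ω
  bounded n := by
    refine ⟨|a| * (2 * |K|), fun ω => ?_⟩
    have h0 : 0 ≤ max (K - walkCentre ε n ω) 0 := le_max_right _ _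
    have h1 : max (K - walkCentre ε n ω) 0 ≤ |K| :=
      max_le (by linarith [walkCentre_nonneg ε n ω, le_abs_self K]) (abs_nonneg K)
    rw [abs_mul, abs_of_nonneg (a := 2 * _) (by positivity)]
    gcongr
  measurable n := by
    have h := (isStoppingTime_and_measurable_walk (T := T) ε n).2
    exact (((h.const_sub K).max measurable_const).const_mul 2).const_mul a

theorem tangent_le (K x y : ℝ) :
    K ^ 2 - max (K - y) 0 ^ 2 ≤ K ^ 2 - max (K - x) 0 ^ 2 + 2 * max (K - x) 0 * (y - x) := by
  rcases max_cases (K - x) 0 with ⟨h1, h2⟩ | ⟨h1, h2⟩ <;>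
  rcases max_cases (K - y) 0 with ⟨h3, h4⟩ | ⟨h3, h4⟩ <;> rw [h1, h3] <;>
  nlinarith [sq_nonneg (x - y), sq_nonneg (K - x)]

theorem tangent_add_sq_eq {K x y : ℝ} (hx : x ≤ K) (hy : y ≤ K) :
    K ^ 2 - max (K - y) 0 ^ 2 + (y - x) ^ 2 =
      K ^ 2 - max (K - x) 0 ^ 2 + 2 * max (K - x) 0 * (y - x) := by
  rw [max_eq_left (sub_nonneg.2 hx), max_eq_left (sub_nonneg.2 hy)]
  ring

/-- The left side follows the tangent to `g` at the centre, not `g` itself, so that a step without a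
move preserves the bound. A move exchanges the tangent value for `g` at the new centre. The choice
`δ = 0` serves all paths and yields nonnegativity; `δ = (ε / 2) ^ 2` is the profit per move,
guaranteed on paths bounded by `K`. -/
theorem le_sum_walk {ε : ℝ} {K δ : ℝ} {ω : Path T} (hε : 0 < ε)
    (hδ : δ = 0 ∨ δ = (ε / 2) ^ 2 ∧ ∀ t, ω t ≤ K) {t : Time T} {n : ℕ}
    (hn : walkTime ε n ω ≤ t) :
    K ^ 2 - max (K - walkCentre ε n ω) 0 ^ 2
        + 2 * max (K - walkCentre ε n ω) 0 * (valueAt ω (walkTime ε n ω) t - walkCentre ε n ω)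
        + δ * walkMoves ε ω n
      ≤ K ^ 2 + ∑ m ∈ Finset.range n, 2 * max (K - walkCentre ε m ω) 0 *
        (valueAt ω (walkTime ε (m + 1) ω) t - valueAt ω (walkTime ε m ω) t) := by
  induction n with
  | zero =>
    rw [walkTime_zero, valueAt_coe ω (startTime_le t), walkCentre_zero]
    -- Here `g ≤ K²`: a constant initial capital has to cover every starting value.
    simp [walkMoves]
  | succ n ih =>
    have ih := ih ((walkTime_le_succ ε n ω).trans hn)
    rw [Finset.sum_range_succ]
    obtain ⟨s, hs, -⟩ := WithTop.le_coe_iff.1 hn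
    have hst : s ≤ t := by rw [hs] at hn; exact_mod_cast hn
    have hmove : walkMoves ε ω (n + 1) = walkMoves ε ω n +
      if ε / 2 ≤ |valueAt ω (walkTime ε (n + 1) ω) (endTime T) - walkCentre ε n ω| then 1 else 0 :=
      rfl
    rw [hmove, walkCentre_succ, hs, valueAt_coe ω hst, valueAt_coe ω (le_endTime s)]
    split_ifs with h
    · push_cast
      rw [sub_self, mul_zero]
      rcases hδ with rfl | ⟨rfl, hK⟩
      · have := tangent_le K (walkCentre ε n ω) (ω s)
        linarith
      · have h1 := tangent_add_sq_eq (walkCentre_le ε n ω hK) (hK s)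
        have h2 : (ε / 2) ^ 2 ≤ (ω s - walkCentre ε n ω) ^ 2 :=
          sq_le_sq.2 (by rwa [abs_of_pos (by positivity : (0 : ℝ) < ε / 2)])
        linarith
    · push_cast
      linarith

theorem le_capital_walkStrategy {ε : ℝ} (hε : 0 < ε) {a K δ : ℝ} (ha : 0 ≤ a) {ω : Path T}
    (hδ : δ = 0 ∨ δ = (ε / 2) ^ 2 ∧ ∀ t, ω t ≤ K) (hK : 0 ≤ K) {t : Time T} {N : ℕ}
    (hN : walkTime ε N ω ≤ t) (hN' : t < walkTime ε (N + 1) ω) :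
    a * (δ * walkMoves ε ω N) ≤ (walkStrategy hε a K).capital t ω := by
  have hcap : (walkStrategy hε a K).capital t ω = a * (K ^ 2 + ∑ m ∈ Finset.range (N + 1),
      2 * max (K - walkCentre ε m ω) 0 *
        (valueAt ω (walkTime ε (m + 1) ω) t - valueAt ω (walkTime ε m ω) t)) := by
    rw [SimpleStrategy.capital_eq, mul_add, Finset.mul_sum]
    congr 1
    rw [finsum_eq_sum_of_support_subset (s := Finset.range (N + 1))]
    · exact Finset.sum_congr rfl fun m _ => mul_assoc _ _ _
    · intro m hm
      by_contra hmN
      simp only [Finset.coe_range, Set.mem_Iio, not_lt] at hmN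
      have h1 : (t : WithTop (Time T)) ≤ walkTime ε m ω :=
        hN'.le.trans (walkTime_mono ε ω hmN)
      refine hm ?_
      change _ * (valueAt ω (walkTime ε (m + 1) ω) t - valueAt ω (walkTime ε m ω) t) = 0
      rw [valueAt_of_ge ω h1, valueAt_of_ge ω (h1.trans (walkTime_le_succ ε m ω)), sub_self,
        mul_zero]
  rw [hcap]
  refine mul_le_mul_of_nonneg_left ?_ ha
  rw [Finset.sum_range_succ, valueAt_of_ge ω hN'.le]
  have h1 := le_sum_walk hε hδ hN
  have h2 := tangent_le K (walkCentre ε N ω) (ω t)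
  -- Nonnegativity of the path enters here, as `g ≥ 0` on `[0,∞)`.
  have h3 : max (K - ω t) 0 ^ 2 ≤ K ^ 2 := by
    have : max (K - ω t) 0 ≤ K := max_le (by linarith [ω.nonneg t]) hK
    exact pow_le_pow_left₀ (le_max_right _ _) this 2
  linarith

theorem capital_walkStrategy_nonneg {ε : ℝ} (hε : 0 < ε) {a K : ℝ} (ha : 0 ≤ a) (hK : 0 ≤ K)
    (t : Time T) (ω : Path T) : 0 ≤ (walkStrategy hε a K).capital t ω := by
  obtain ⟨N, hN, hN'⟩ := exists_walkTime_le_lt hε ω t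
  simpa using le_capital_walkStrategy hε ha (Or.inl rfl) hK hN hN'

theorem card_le_capital_walkStrategy {ε : ℝ} (hε : 0 < ε) {a K : ℝ} (ha : 0 ≤ a) (hK : 0 ≤ K)
    {ω : Path T} (hω : ∀ t, ω t ≤ K) {n : ℕ} {t : Fin (n + 1) → Time T} (ht : Monotone t) :
    a * ((ε / 2) ^ 2 *
      (Finset.univ.filter fun i : Fin n => 2 * ε ≤ |ω (t i.succ) - ω (t i.castSucc)|).card)
      ≤ (walkStrategy hε a K).capital (endTime T) ω := by
  obtain ⟨N, hN, hN'⟩ := exists_walkTime_le_lt hε ω (endTime T)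
  refine le_trans ?_ (le_capital_walkStrategy hε ha (Or.inr ⟨rfl, hω⟩) hK hN hN')
  have := card_le_walkMoves hε ω hN' ht
  gcongr

/-! ### From counts to the variation. -/

theorem le_pow_mul_of_doubling {φ : ℝ≥0 → ℝ≥0} {C : ℝ≥0}
    (hφ : ∀ t s, 0 < t → t ≤ s → s ≤ 2 * t → φ s ≤ C * φ t) (L : ℕ) {d : ℝ≥0} (h1 : 1 ≤ d)
    (hd : d ≤ 2 ^ L) : φ d ≤ C ^ L * φ 1 := by
  induction L generalizing d with
  | zero =>
    obtain rfl : d = 1 := le_antisymm (by simpa using hd) h1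
    simp
  | succ L ih =>
    have hdd : d / 2 * 2 = d := div_mul_cancel₀ d two_ne_zero
    -- The maximum with `1` keeps the argument admissible for `ih` when `d < 2`.
    have he := ih (d := max (d / 2) 1) (le_max_right _ _)
      (max_le (by rw [div_le_iff₀ two_pos, ← pow_succ]; exact hd) (one_le_pow₀ one_le_two))
    refine (hφ (max (d / 2) 1) d (by positivity) (max_le (half_le_self d.2) h1) ?_).trans ?_
    · rw [mul_comm]
      exact hdd.symm.le.trans (by gcongr; exact le_max_left _ _)
    · rw [pow_succ', mul_assoc]
      gcongr

/-- One term of the series suffices: for `d ≤ 1` a dyadic `2⁻ʲ < d ≤ 2 · 2⁻ʲ`, at the cost of one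
factor `C`; for `d ≥ 1` the term `j = 0`, at the cost of `L` factors. The exponent `L + 1` covers
both. -/
theorem update_le_tsum_of_doubling {φ : ℝ≥0 → ℝ≥0} {C : ℝ≥0} (hC : 1 ≤ C)
    (hφ : ∀ t s, 0 < t → t ≤ s → s ≤ 2 * t → φ s ≤ C * φ t) (L : ℕ) {d : ℝ≥0}
    (hd : d ≤ 2 ^ L) :
    (Function.update φ 0 0 d : ℝ≥0∞) ≤ (C : ℝ≥0∞) ^ (L + 1) *
      ∑' j : ℕ, if (2 : ℝ≥0)⁻¹ ^ j ≤ d then (φ ((2 : ℝ≥0)⁻¹ ^ j) : ℝ≥0∞) else 0 := by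
  suffices h : ∃ j : ℕ, (2 : ℝ≥0)⁻¹ ^ j ≤ d ∧
      Function.update φ 0 0 d ≤ C ^ (L + 1) * φ ((2 : ℝ≥0)⁻¹ ^ j) ∨ d = 0 by
    obtain ⟨j, ⟨hj, hle⟩ | rfl⟩ := h
    · refine le_trans ?_ (mul_le_mul_right (ENNReal.le_tsum j) _)
      rw [if_pos hj]
      exact_mod_cast hle
    · simp
  rcases eq_or_ne d 0 with rfl | hd0
  · exact ⟨0, Or.inr rfl⟩
  rw [Function.update_of_ne hd0]
  rcases le_total d 1 with h1 | h1
  · obtain ⟨j, hj1, hj2⟩ := exists_nat_pow_near_of_lt_one (pos_iff_ne_zero.2 hd0) h1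
      (y := (2 : ℝ≥0)⁻¹) (by positivity) (inv_lt_one_of_one_lt₀ one_lt_two)
    refine ⟨j + 1, Or.inl ⟨hj1.le, (hφ _ d (by positivity) hj1.le ?_).trans ?_⟩⟩
    · rw [pow_succ', mul_inv_cancel_left₀ two_ne_zero]
      exact hj2
    · gcongr
      exact le_self_pow₀ hC (by omega)
  · refine ⟨0, Or.inl ⟨by simpa using h1, (le_pow_mul_of_doubling hφ L h1 hd).trans ?_⟩⟩
    rw [pow_zero]
    gcongr
    omega

theorem phiVariation_le_of_doubling {φ : ℝ≥0 → ℝ≥0} {C : ℝ≥0} (hC : 1 ≤ C)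
    (hφ : ∀ t s, 0 < t → t ≤ s → s ≤ 2 * t → φ s ≤ C * φ t) (L : ℕ) {ω : Path T}
    (hω : ∀ t, ω t ≤ 2 ^ L) :
    phiVariation (Function.update φ 0 0) ω ≤ (C : ℝ≥0∞) ^ (L + 1) * (16 *
      ∑' j : ℕ, ((2 : ℝ≥0) ^ (2 * j) * φ ((2 : ℝ≥0)⁻¹ ^ j) : ℝ≥0) *
        ENNReal.ofReal ((walkStrategy (T := T) (ε := 2⁻¹ ^ j / 2) (by positivity) 1
          (2 ^ L)).capital (endTime T) ω)) := by
  refine iSup_le fun n => iSup_le fun _ => iSup_le fun t => iSup_le fun ht => iSup_le fun _ =>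
    iSup_le fun _ => ?_
  have hd : ∀ i : Fin n, ‖ω (t i.succ) - ω (t i.castSucc)‖₊ ≤ 2 ^ L := by
    intro i
    rw [← NNReal.coe_le_coe]
    push_cast
    rw [Real.norm_eq_abs, abs_le]
    constructor <;> linarith [hω (t i.succ), hω (t i.castSucc), ω.nonneg (t i.succ),
      ω.nonneg (t i.castSucc)]
  refine (Finset.sum_le_sum fun i _ => update_le_tsum_of_doubling hC hφ L (hd i)).trans ?_
  rw [← Finset.mul_sum, ← Summable.tsum_finsetSum fun _ _ => ENNReal.summable,
    ← ENNReal.tsum_mul_left (a := 16)]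
  refine mul_le_mul_right (ENNReal.tsum_le_tsum fun j => ?_) _
  have hcard := card_le_capital_walkStrategy (T := T) (ε := 2⁻¹ ^ j / 2) (by positivity)
    zero_le_one (by positivity) hω ht
  set U := (walkStrategy (T := T) (ε := 2⁻¹ ^ j / 2) (by positivity) 1
    (2 ^ L)).capital (endTime T) ω
  rw [← Finset.sum_filter, Finset.sum_const, nsmul_eq_mul]
  have hfilter : (Finset.univ.filter fun i : Fin n =>
      (2 : ℝ≥0)⁻¹ ^ j ≤ ‖ω (t i.succ) - ω (t i.castSucc)‖₊) =
      Finset.univ.filter fun i : Fin n =>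
        2 * ((2 : ℝ)⁻¹ ^ j / 2) ≤ |ω (t i.succ) - ω (t i.castSucc)| := by
    ext i
    rw [Finset.mem_filter_univ, Finset.mem_filter_univ, ← NNReal.coe_le_coe]
    push_cast
    rw [Real.norm_eq_abs, mul_div_cancel₀ _ (two_ne_zero)]
  rw [hfilter]
  set k := (Finset.univ.filter fun i : Fin n =>
    2 * ((2 : ℝ)⁻¹ ^ j / 2) ≤ |ω (t i.succ) - ω (t i.castSucc)|).card
  -- With `ε = 2⁻ʲ / 2` the profit per move is `(2⁻ʲ / 4)²`, whence `16`.
  have hk : (k : ℝ) ≤ 16 * (2 ^ (2 * j) * U) := by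
    have hpow : (2 : ℝ) ^ (2 * j) * (2⁻¹ ^ j) ^ 2 = 1 := by
      rw [← pow_mul, mul_comm j 2, ← mul_pow]
      norm_num
    calc (k : ℝ) = 16 * (2 ^ (2 * j) * (1 * ((2⁻¹ ^ j / 2 / 2) ^ 2 * k))) := by
          linear_combination -(k : ℝ) * hpow
      _ ≤ _ := by gcongr
  have hk' : (k : ℝ≥0∞) ≤ 16 * (2 ^ (2 * j) * ENNReal.ofReal U) := by
    have := ENNReal.ofReal_le_ofReal hk
    rw [ENNReal.ofReal_natCast, ENNReal.ofReal_mul (by norm_num), ENNReal.ofReal_mul (by positivity),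
      ENNReal.ofReal_pow (by norm_num)] at this
    simpa using this
  calc (k : ℝ≥0∞) * φ (2⁻¹ ^ j) ≤ 16 * (2 ^ (2 * j) * ENNReal.ofReal U) * φ (2⁻¹ ^ j) := by gcongr
    _ = _ := by push_cast; ring

/-! ### The mixture over scales and bounds. -/

theorem capital_walkStrategy_eq_mul {ε : ℝ} (hε : 0 < ε) (a K : ℝ) (t : Time T) (ω : Path T) :
    (walkStrategy hε a K).capital t ω = a * (walkStrategy hε 1 K).capital t ω := by
  rw [SimpleStrategy.capital_eq, SimpleStrategy.capital_eq, mul_add,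
    mul_finsum' _ _ ((walkStrategy hε 1 K).finite_support_gains t ω)]
  congr 1
  · simp [walkStrategy]
  · refine finsum_congr fun n => ?_
    simp only [walkStrategy, one_mul, mul_assoc]

theorem exists_doubling_constant {φ : ℝ≥0 → ℝ≥0} (hpos : ∀ t, 0 < t → 0 < φ t)
    (hsup : (⨆ (t : ℝ≥0) (s : ℝ≥0) (_ : 0 < t) (_ : t ≤ s) (_ : s ≤ 2 * t),
      ((φ s / φ t : ℝ≥0) : ℝ≥0∞)) < ∞) :
    ∃ C : ℝ≥0, 1 ≤ C ∧ ∀ t s, 0 < t → t ≤ s → s ≤ 2 * t → φ s ≤ C * φ t := by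
  lift (⨆ (t : ℝ≥0) (s : ℝ≥0) (_ : 0 < t) (_ : t ≤ s) (_ : s ≤ 2 * t),
      ((φ s / φ t : ℝ≥0) : ℝ≥0∞)) to ℝ≥0 using hsup.ne with C hC
  refine ⟨max 1 C, le_max_left _ _, fun t s h1 h2 h3 => ?_⟩
  rw [← div_le_iff₀ (hpos t h1)]
  refine le_trans ?_ (le_max_right _ _)
  rw [← ENNReal.coe_le_coe, hC]
  exact le_iSup_of_le t <| le_iSup_of_le s <| le_iSup_of_le h1 <| le_iSup_of_le h2 <|
    le_iSup_of_le h3 le_rfl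

end CadlagPrice

open CadlagPrice in
/-- Only the values of `φ` on `(0,∞)` matter: `Function.update φ 0 0` sets `φ(0)` to `0`. -/
theorem mainTheorem2 (T : ℝ≥0) (φ : ℝ≥0 → ℝ≥0) (hpos : ∀ t, 0 < t → 0 < φ t)
    (hsup : (⨆ (t : ℝ≥0) (s : ℝ≥0) (_ : 0 < t) (_ : t ≤ s) (_ : s ≤ 2 * t),
      ((φ s / φ t : ℝ≥0) : ℝ≥0∞)) < ∞)
    (hsum : (∑' j : ℕ, (((2 : ℝ≥0) ^ (2 * j) * φ ((2 : ℝ≥0)⁻¹ ^ j) : ℝ≥0) : ℝ≥0∞)) < ∞) :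
    CadlagPrice.ForTypical (T := T) fun ω =>
      CadlagPrice.phiVariation (Function.update φ 0 0) ω < ∞ := by
  obtain ⟨C, hC1, hC⟩ := exists_doubling_constant hpos hsup
  set b : ℕ → ℝ≥0 := fun j => (2 : ℝ≥0) ^ (2 * j) * φ ((2 : ℝ≥0)⁻¹ ^ j)
  set Z : ℝ≥0∞ := 2 * ∑' j, (b j : ℝ≥0∞) with hZ
  have hZtop : Z ≠ ∞ := ENNReal.mul_ne_top ENNReal.ofNat_ne_top hsum.ne
  have hZ0 : Z ≠ 0 := by
    have h0 : 0 < b 0 := mul_pos (by positivity) (hpos _ (by positivity))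
    refine mul_ne_zero two_ne_zero fun h => h0.ne' ?_
    exact_mod_cast ENNReal.tsum_eq_zero.1 h 0
  lift Z to ℝ≥0 using hZtop with z
  have hz0 : z ≠ 0 := by exact_mod_cast hZ0
  -- The factor `(2 ^ L) ^ 2` cancels the initial capital `K²`; the other `2 ^ L` makes the sum over
  -- `L` converge to the `2` in `Z`.
  let w : ℕ × ℕ → ℝ≥0 := fun p => z⁻¹ * ((2 ^ p.1 * (2 ^ p.1) ^ 2)⁻¹ * b p.2)
  let G : ℕ × ℕ → SimpleStrategy T := fun p =>
    walkStrategy (ε := 2⁻¹ ^ p.2 / 2) (by positivity) (w p) (2 ^ p.1)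
  let e : ℕ ≃ ℕ × ℕ := Nat.pairEquiv.symm
  refine isNull_of_strategies (fun m => G (e m)) (fun m => ?_)
    (fun m t ω => capital_walkStrategy_nonneg _ (NNReal.coe_nonneg _) (by positivity) t ω) ?_
    fun ω hω => ?_
  · exact mul_nonneg (NNReal.coe_nonneg _) (by positivity)
  · rw [e.tsum_eq (fun p => ENNReal.ofReal (G p).c)]
    have hc : ∀ p : ℕ × ℕ, ENNReal.ofReal (G p).c =
        (z : ℝ≥0∞)⁻¹ * ((2⁻¹ : ℝ≥0∞) ^ p.1 * b p.2) := by
      intro p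
      have h1 : (G p).c = ((z⁻¹ * (2⁻¹ ^ p.1 * b p.2) : ℝ≥0) : ℝ) := by
        simp only [G, w, walkStrategy]
        push_cast
        have : (2 : ℝ) ^ p.1 ≠ 0 := by positivity
        rw [inv_pow]
        field_simp
      rw [h1, ENNReal.ofReal_coe_nnreal, ENNReal.coe_mul, ENNReal.coe_inv hz0]
      simp [ENNReal.inv_pow]
    simp_rw [hc]
    rw [ENNReal.tsum_mul_left, ENNReal.tsum_prod']
    simp_rw [ENNReal.tsum_mul_left]
    rw [ENNReal.tsum_mul_right, ENNReal.tsum_geometric, ENNReal.one_sub_inv_two, inv_inv, ← hZ]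
    exact ENNReal.inv_mul_cancel (by exact_mod_cast hz0) ENNReal.coe_ne_top
  · rw [e.tsum_eq (fun p => ENNReal.ofReal ((G p).capital (endTime T) ω)), ENNReal.tsum_prod']
    obtain ⟨K, hK⟩ := ω.exists_forall_le
    obtain ⟨L, hL⟩ := pow_unbounded_of_one_lt K (one_lt_two (α := ℝ))
    have hvar := phiVariation_le_of_doubling hC1 hC L (ω := ω) fun t => (hK t).trans hL.le
    rw [top_le_iff.1 (not_lt.1 hω), top_le_iff] at hvar
    have hinf : ∑' j : ℕ, (b j : ℝ≥0∞) * ENNReal.ofReal ((walkStrategy (T := T)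
        (ε := 2⁻¹ ^ j / 2) (by positivity) 1 (2 ^ L)).capital (endTime T) ω) = ∞ := by
      by_contra h
      exact ENNReal.mul_ne_top (ENNReal.pow_ne_top ENNReal.coe_ne_top)
        (ENNReal.mul_ne_top ENNReal.ofNat_ne_top h) hvar
    -- One row is enough, that of a bound `2 ^ L` for this path.
    refine ENNReal.tsum_eq_top_of_eq_top ⟨L, ?_⟩
    have hcap : ∀ j, ENNReal.ofReal ((G (L, j)).capital (endTime T) ω) =
        ((z⁻¹ * (2 ^ L * (2 ^ L) ^ 2)⁻¹ : ℝ≥0) : ℝ≥0∞) * ((b j : ℝ≥0∞) *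
          ENNReal.ofReal ((walkStrategy (T := T) (ε := 2⁻¹ ^ j / 2) (by positivity) 1
            (2 ^ L)).capital (endTime T) ω)) := by
      intro j
      simp only [G]
      rw [capital_walkStrategy_eq_mul, ENNReal.ofReal_mul (NNReal.coe_nonneg _),
        ENNReal.ofReal_coe_nnreal, ← mul_assoc, ← ENNReal.coe_mul, mul_assoc]
    simp_rw [hcap]
    rw [ENNReal.tsum_mul_left, hinf]
    refine ENNReal.mul_top ?_
    have : z⁻¹ * (2 ^ L * (2 ^ L) ^ 2)⁻¹ ≠ 0 := by positivity
    exact_mod_cast this
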